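/- Let $n,m\ge 0$ be integers and let $L:\mathbb{R}^n\times\mathbb{R}^m\to\mathbb{R}$, $f_i:\mathbb{R}^{n_i}\to\mathbb{R}$ ($1\le i\le n$) and $g_j:\mathbb{R}^{m_j}\to\mathbb{R}$ ($1\le j\le m$) be $C^2$ functions. Suppose that $L$ is strictly convex concave: $L(\cdot,y)$ is convex for every $y$, $L(x,\cdot)$ is concave for every $x$, and for every pair $(x,y)$ either $L(\cdot,y)$ is strictly convex or $L(x,\cdot)$ is strictly concave. Let $\mathrm{Solution}(L)$ be the set of saddle points of $L$, that is, of all $(p,q)\in\mathbb{R}^n\times\mathbb{R}^m$ with $L(p,y)\le L(p,q)\le L(x,q)$ for all $x\in\mathbb{R}^n$, $y\in\mathbb{R}^m$. For a $C^2$ function $k:\mathbb{R}^d\to\mathbb{R}$ and a point $x_0\in\mathbb{R}^d$, let $\gamma$ be the maximal (forward and backward in time) solution of $\dot\gamma=\nabla k(\gamma)$, $\gamma(0)=x_0$. Let $\mathrm{Im}_k(x_0)\subseteq\mathbb{R}$ be the image of $k\circ\gamma$, and for $c\in\mathrm{Im}_k(x_0)$ let $X^k_{x_0}(c)$ be the unique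 point of the trajectory $\gamma$ at which $k$ takes the value $c$. Fix an initialization $\theta(0)=(\theta_i(0))_{i\le n}$, $\phi(0)=(\phi_j(0))_{j\le m}$ with $\theta_i(0)\in\mathbb{R}^{n_i}$, $\phi_j(0)\in\mathbb{R}^{m_j}$. It is called safe for $(p,q)\in\mathrm{Solution}(L)$ if for all $i$ and $j$: $\nabla f_i(\theta_i(0))\neq 0$, $\nabla g_j(\phi_j(0))\neq 0$, $p_i\in\mathrm{Im}_{f_i}(\theta_i(0))$ and $q_j\in\mathrm{Im}_{g_j}(\phi_j(0))$. Let $Z\subseteq\mathrm{Solution}(L)$ be the set of all solutions for which $(\theta(0),\phi(0))$ is safe, and suppose that $Z$ is nonempty. Consider, on the domain $D=\prod_i \mathrm{Im}_{f_i}(\theta_i(0))\times\prod_j \mathrm{Im}_{g_j}(\phi_j(0))\subseteq\mathbb{R}^n\times\mathbb{R}^m$, the dynamics of the outputs $F=(f_i)_i$, $G=(g_j)_j$ induced by gradient descent-ascent on $L(F(\theta),G(\phi))$: $$\dot f_i=-\bigl\|\nabla f_i\bigl(X^{f_i}_{\theta_i(0)}(f_i)\bigr)\bigr\|^2\,\frac{\partial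 L}{\partial f_i}(F,G),\qquad \dot g_j=\bigl\|\nabla g_j\bigl(X^{g_j}_{\phi_j(0)}(g_j)\bigr)\bigr\|^2\,\frac{\partial L}{\partial g_j}(F,G).$$ Then $Z$ is locally asymptotically stable for these dynamics: there is a neighborhood $R$ of the set $Z$ such that from every point of $R$ there starts a trajectory in $D$ defined for all $t\ge 0$, and every such trajectory $(F(t),G(t))$ satisfies $\mathrm{dist}\bigl((F(t),G(t)),Z\bigr)\to 0$ as $t\to+\infty$. -/

import Mathlib

open Set Filter Topology
open scoped Gradient

namespace HiddenGame

noncomputable section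

/-- Euclidean space of dimension `d`, with the `ℓ²` norm. -/
abbrev Vec (d : ℕ) : Type := EuclideanSpace ℝ (Fin d)

/-- The output space `ℝⁿ × ℝᵐ`, with the `ℓ²` norm. Its points are the pairs `(F, G)`. -/
abbrev OutputSpace (n m : ℕ) : Type := WithLp 2 (Vec n × Vec m)

/-! ### Convex-concave functions and their solutions -/

/-- `L` is convex in its first and concave in its second argument. -/
def IsConvexConcave {n m : ℕ} (L : Vec n → Vec m → ℝ) : Prop :=
  (∀ y, ConvexOn ℝ univ (fun x => L x y)) ∧ (∀ x, ConcaveOn ℝ univ (fun y => L x y))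

/-- `L` is convex concave and, for every pair `(x, y)`, strict in at least one argument. -/
def IsStrictlyConvexConcave {n m : ℕ} (L : Vec n → Vec m → ℝ) : Prop :=
  IsConvexConcave L ∧
    ∀ x y, StrictConvexOn ℝ univ (fun x' => L x' y) ∨ StrictConcaveOn ℝ univ (fun y' => L x y')

/-- The von Neumann solutions of `L`: the equilibria (saddle points) of `min_x max_y L x y`. -/
def Solution {n m : ℕ} (L : Vec n → Vec m → ℝ) : Set (OutputSpace n m) :=
  {z | (∀ y, L z.fst y ≤ L z.fst z.snd) ∧ (∀ x, L z.fst z.snd ≤ L x z.snd)}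

/-! ### Gradient ascent -/

/-- `γ` solves the gradient ascent equation `γ' = ∇k(γ)`, `γ 0 = x₀` on the open interval
`(a, b)`, which contains `0`. -/
def IsGradientAscent {d : ℕ} (k : Vec d → ℝ) (x₀ : Vec d) (γ : ℝ → Vec d) (a b : ℝ) : Prop :=
  a < 0 ∧ 0 < b ∧ γ 0 = x₀ ∧ ∀ t ∈ Ioo a b, HasDerivAt γ (∇ k (γ t)) t

/-- The full (forward and backward) orbit of `x₀` under gradient ascent on `k`: all the points
`γ t` on the solution with `γ 0 = x₀`, where `t` runs over the maximal interval of existence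
(the union of all the intervals on which a solution exists; this is `ℝ` when the solution is
global). -/
def orbit {d : ℕ} (k : Vec d → ℝ) (x₀ : Vec d) : Set (Vec d) :=
  {y | ∃ (γ : ℝ → Vec d) (a b : ℝ), IsGradientAscent k x₀ γ a b ∧ ∃ t ∈ Ioo a b, γ t = y}

/-- The range of values `k` attains along the full gradient ascent solution through `x₀`. -/
def ascentRange {d : ℕ} (k : Vec d → ℝ) (x₀ : Vec d) : Set ℝ := k '' orbit k x₀

/-- The map `X_{x₀}` which recovers the point of the orbit of `x₀` from its value under `k`.
(As `k` is injective on the orbit, this pins down its values on `ascentRange k x₀`.) -/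
def paramOfValue {d : ℕ} (k : Vec d → ℝ) (x₀ : Vec d) : ℝ → Vec d :=
  Function.invFunOn k (orbit k x₀)

/-! ### Safety and the induced dynamics of the outputs -/

section Dynamics

variable {n m : ℕ} {dθ : Fin n → ℕ} {dφ : Fin m → ℕ}

/-- The initialization `(θ₀, φ₀)` is safe for `z = (p, q)`: no block of it is a stationary point,
and every coordinate of `p` and `q` is attainable. -/
def IsSafe (f : ∀ i, Vec (dθ i) → ℝ) (g : ∀ j, Vec (dφ j) → ℝ)
    (θ₀ : ∀ i, Vec (dθ i)) (φ₀ : ∀ j, Vec (dφ j)) (z : OutputSpace n m) : Prop :=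
  (∀ i, ∇ (f i) (θ₀ i) ≠ 0 ∧ z.fst i ∈ ascentRange (f i) (θ₀ i)) ∧
    (∀ j, ∇ (g j) (φ₀ j) ≠ 0 ∧ z.snd j ∈ ascentRange (g j) (φ₀ j))

/-- The set `Z` of the von Neumann solutions of `L` for which `(θ₀, φ₀)` is safe. -/
def SafeSolution (L : Vec n → Vec m → ℝ) (f : ∀ i, Vec (dθ i) → ℝ) (g : ∀ j, Vec (dφ j) → ℝ)
    (θ₀ : ∀ i, Vec (dθ i)) (φ₀ : ∀ j, Vec (dφ j)) : Set (OutputSpace n m) :=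
  {z | z ∈ Solution L ∧ IsSafe f g θ₀ φ₀ z}

/-- The domain of the induced output dynamics: the product of the attainable ranges. -/
def outputDomain (f : ∀ i, Vec (dθ i) → ℝ) (g : ∀ j, Vec (dφ j) → ℝ)
    (θ₀ : ∀ i, Vec (dθ i)) (φ₀ : ∀ j, Vec (dφ j)) : Set (OutputSpace n m) :=
  {z | (∀ i, z.fst i ∈ ascentRange (f i) (θ₀ i)) ∧ (∀ j, z.snd j ∈ ascentRange (g j) (φ₀ j))}

/-- `z = (F, G)` is a trajectory, for all times `t ≥ 0`, of the dynamics that gradient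
descent-ascent induces on the outputs:
`fᵢ' = - ‖∇ fᵢ (X_{θ₀ᵢ} fᵢ)‖² ∂L/∂fᵢ (F, G)` and `gⱼ' = ‖∇ gⱼ (X_{φ₀ⱼ} gⱼ)‖² ∂L/∂gⱼ (F, G)`. -/
def IsOutputTrajectory (L : Vec n → Vec m → ℝ) (f : ∀ i, Vec (dθ i) → ℝ)
    (g : ∀ j, Vec (dφ j) → ℝ) (θ₀ : ∀ i, Vec (dθ i)) (φ₀ : ∀ j, Vec (dφ j))
    (z : ℝ → OutputSpace n m) : Prop :=
  ∀ t, 0 ≤ t →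
    z t ∈ outputDomain f g θ₀ φ₀ ∧
    (∀ i, HasDerivWithinAt (fun s => (z s).fst i)
      (-(‖∇ (f i) (paramOfValue (f i) (θ₀ i) ((z t).fst i))‖ ^ 2 *
        ∇ (fun x => L x (z t).snd) (z t).fst i)) (Ici 0) t) ∧
    (∀ j, HasDerivWithinAt (fun s => (z s).snd j)
      (‖∇ (g j) (paramOfValue (g j) (φ₀ j) ((z t).snd j))‖ ^ 2 *
        ∇ (fun y => L (z t).fst y) (z t).snd j) (Ici 0) t)

end Dynamics

/-! ### Asymptotic stability of a set -/

/-- `z t` approaches the set `S` as `t → ∞`. -/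
def Approaches {X : Type*} [PseudoMetricSpace X] (z : ℝ → X) (S : Set X) : Prop :=
  ∀ ε > 0, ∃ T > 0, ∀ t > T, Metric.infDist (z t) S < ε

/-- The set `S` is (locally) asymptotically stable for the dynamics whose trajectories on `[0, ∞)`
are given by `IsTraj`: it has a neighborhood `R` such that from each point of `R` there starts a
trajectory for all times `t ≥ 0`, and each such trajectory approaches `S`. -/
def IsAsymptoticallyStable {X : Type*} [PseudoMetricSpace X] (IsTraj : (ℝ → X) → Prop)
    (S : Set X) : Prop :=
  ∃ R ∈ 𝓝ˢ S, ∀ x₀ ∈ R,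
    (∃ z, IsTraj z ∧ z 0 = x₀) ∧ ∀ z, IsTraj z → z 0 = x₀ → Approaches z S

end

end HiddenGame

namespace HiddenGame

/-! ### Uniqueness for autonomous differential equations -/

/-! In coordinates the output dynamics read `zₛ' = ρₛ(zₛ) Φₛ(z)`, where `Φ` is the descent-ascent
field of `L` and `ρₛ` is a squared gradient norm. A nonstationary gradient orbit never meets a
stationary point, so `ρₛ > 0`, and `ρₛ` is `C¹` on an open interval.

Fix a safe solution `(p, q)`, written `p` in coordinates. The weight `1/ρₛ` cancels the speed: `V(z)
= ∑ₛ ∫ (c - pₛ)/ρₛ(c) dc`, integrated from `pₛ` to `zₛ`, has derivative `∑ₛ (zₛ - pₛ) Φₛ(z)` along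
trajectories. With `z = (x, y)`, the gradient inequalities for convex and concave functions bound
this by `L(p, y) - L(x, q) ≤ 0` (`descentAscentPairing_le`). Hence trajectories starting near `p`
stay in a compact box, and `V` converges along them. Global existence follows by truncating the
field outside the box (`exists_separableTrajectory`).

Barbalat's lemma then replaces LaSalle's principle. It gives `V' → 0`, so every limit point
satisfies `L(p, y) = L(p, q) = L(x, q)`. Strictness at `(p, q)` fixes one block of the limit point,
say `x = p`. That block therefore converges, and a second use of Barbalat's lemma shows that `∂L/∂x
→ 0`. By convexity the limit point is a saddle point (`mem_solution_of_tendsto`). It lies in the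
box, so it is safe, and compactness turns this into convergence of the distance to `Z`. -/

theorem eqOn_Ioo_of_contDiff {E : Type*} [NormedAddCommGroup E] [NormedSpace ℝ E] [ProperSpace E]
    {v : E → E} (hv : ContDiff ℝ 1 v) {α β : ℝ → E} {a b t₀ : ℝ} (ht₀ : t₀ ∈ Ioo a b)
    (hα : ∀ t ∈ Ioo a b, HasDerivAt α (v (α t)) t) (hβ : ∀ t ∈ Ioo a b, HasDerivAt β (v (β t)) t)
    (h : α t₀ = β t₀) : EqOn α β (Ioo a b) := by
  intro t ht
  -- `v` is only locally Lipschitz: on a compact subinterval containing `t` and `t₀`, both curves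
  -- lie in one closed ball, where `v` is Lipschitz.
  obtain ⟨c, hac, hc⟩ := exists_between (lt_min ht.1 ht₀.1)
  obtain ⟨d, hd, hdb⟩ := exists_between (max_lt ht.2 ht₀.2)
  rw [lt_min_iff] at hc
  rw [max_lt_iff] at hd
  have hsub : Icc c d ⊆ Ioo a b := fun s hs => ⟨hac.trans_le hs.1, hs.2.trans_lt hdb⟩
  have hαc : ContinuousOn α (Icc c d) :=
    fun s hs => (hα s (hsub hs)).continuousAt.continuousWithinAt
  have hβc : ContinuousOn β (Icc c d) :=
    fun s hs => (hβ s (hsub hs)).continuousAt.continuousWithinAt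
  obtain ⟨r, hr⟩ := ((isCompact_Icc.image_of_continuousOn hαc).union
    (isCompact_Icc.image_of_continuousOn hβc)).isBounded.subset_closedBall 0
  obtain ⟨K, hK⟩ := hv.contDiffOn.exists_lipschitzOnWith one_ne_zero
    (convex_closedBall (0 : E) r) (isCompact_closedBall 0 r)
  refine ODE_solution_unique_of_mem_Icc (v := fun _ => v) (s := fun _ => Metric.closedBall 0 r)
    (fun _ _ => hK) (t₀ := t₀) ⟨hc.2, hd.2⟩ hαc (fun s hs => hα s (hsub (Ioo_subset_Icc_self hs)))
    (fun s hs => hr (Or.inl (mem_image_of_mem _ (Ioo_subset_Icc_self hs)))) hβc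
    (fun s hs => hβ s (hsub (Ioo_subset_Icc_self hs)))
    (fun s hs => hr (Or.inr (mem_image_of_mem _ (Ioo_subset_Icc_self hs)))) h ⟨hc.1.le, hd.1.le⟩

/-! ### Orbits of gradient ascent -/

section Orbit

variable {d : ℕ} {k : Vec d → ℝ} {x₀ : Vec d}

theorem contDiff_gradient {n : WithTop ℕ∞} (hk : ContDiff ℝ (n + 1) k) : ContDiff ℝ n (∇ k) :=
  (InnerProductSpace.toDual ℝ (Vec d)).symm.contDiff.comp (hk.fderiv_right le_rfl)

theorem contDiff_one_gradient (hk : ContDiff ℝ 2 k) : ContDiff ℝ 1 (∇ k) :=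
  contDiff_gradient (by simpa [one_add_one_eq_two] using hk)

/-- The gradient ascent solution on its maximal interval of existence. -/
theorem exists_maximal_gradientAscent (hk : ContDiff ℝ 2 k) (x₀ : Vec d) :
    ∃ (J : Set ℝ) (Γ : ℝ → Vec d), IsOpen J ∧ IsPreconnected J ∧ 0 ∈ J ∧ Γ 0 = x₀ ∧
      (∀ t ∈ J, HasDerivAt Γ (∇ k (Γ t)) t) ∧ orbit k x₀ = Γ '' J := by
  classical
  have hv := contDiff_one_gradient hk
  let J : Set ℝ := {t | ∃ (γ : ℝ → Vec d) (a b : ℝ), IsGradientAscent k x₀ γ a b ∧ t ∈ Ioo a b}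
  choose! γ a b hγ hmem using fun t (ht : t ∈ J) => ht
  -- The maximal solution is the diagonal `t ↦ γ t t` of chosen local solutions; uniqueness makes it
  -- independent of the choices.
  have key : ∀ (α : ℝ → Vec d) (c e : ℝ), IsGradientAscent k x₀ α c e →
      ∀ t ∈ Ioo c e, γ t t = α t := by
    intro α c e hα t ht
    have htJ : t ∈ J := ⟨α, c, e, hα, ht⟩
    obtain ⟨ha, hb, h0, hd⟩ := hγ t htJ
    obtain ⟨hc, he, h0', hd'⟩ := hα
    refine eqOn_Ioo_of_contDiff hv (t₀ := 0) (a := max (a t) c) (b := min (b t) e)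
      ⟨max_lt ha hc, lt_min hb he⟩ (fun s hs => hd s ?_) (fun s hs => hd' s ?_) (h0.trans h0'.symm)
      ⟨max_lt (hmem t htJ).1 ht.1, lt_min (hmem t htJ).2 ht.2⟩
    · exact ⟨(le_max_left _ _).trans_lt hs.1, hs.2.trans_le (min_le_left _ _)⟩
    · exact ⟨(le_max_right _ _).trans_lt hs.1, hs.2.trans_le (min_le_right _ _)⟩
  have h0J : (0 : ℝ) ∈ J := by
    obtain ⟨α, hα0, ε, hε, hα⟩ :=
      (hv.contDiffAt (x := x₀)).exists_forall_mem_closedBall_exists_eq_forall_mem_Ioo_hasDerivAt₀ 0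
    exact ⟨α, 0 - ε, 0 + ε, ⟨by linarith, by linarith, hα0, hα⟩, by simpa using hε⟩
  refine ⟨J, fun t => γ t t, ?_, ?_, h0J, (hγ 0 h0J).2.2.1, ?_, ?_⟩
  · rw [isOpen_iff_mem_nhds]
    rintro t ⟨α, c, e, hα, ht⟩
    filter_upwards [isOpen_Ioo.mem_nhds ht] with s hs using ⟨α, c, e, hα, hs⟩
  · refine isPreconnected_of_forall 0 ?_
    rintro t ⟨α, c, e, hα, ht⟩
    exact ⟨Ioo c e, fun s hs => ⟨α, c, e, hα, hs⟩, ⟨hα.1, hα.2.1⟩, ht, isPreconnected_Ioo⟩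
  · rintro t ⟨α, c, e, hα, ht⟩
    have := hα.2.2.2 t ht
    rw [← key α c e hα t ht] at this
    refine this.congr_of_eventuallyEq ?_
    filter_upwards [isOpen_Ioo.mem_nhds ht] with s hs using key α c e hα s hs
  · ext y
    constructor
    · rintro ⟨α, c, e, hα, t, ht, rfl⟩
      exact ⟨t, ⟨α, c, e, hα, ht⟩, key α c e hα t ht⟩
    · rintro ⟨t, ht, rfl⟩
      exact ⟨γ t, a t, b t, hγ t ht, t, hmem t ht, rfl⟩

/-- By uniqueness, a solution that reaches a stationary point is the constant one, so `x₀` would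
itself be stationary. -/
theorem gradient_ne_zero_of_mem_orbit (hk : ContDiff ℝ 2 k) (h0 : ∇ k x₀ ≠ 0) {y : Vec d}
    (hy : y ∈ orbit k x₀) : ∇ k y ≠ 0 := by
  obtain ⟨γ, a, b, ⟨ha, hb, rfl, hγ⟩, t, ht, rfl⟩ := hy
  intro hzero
  have := eqOn_Ioo_of_contDiff (contDiff_one_gradient hk) ht hγ (β := fun _ => γ t)
    (fun s _ => by simpa [hzero] using hasDerivAt_const s (γ t)) rfl ⟨ha, hb⟩
  exact h0 (by rw [this]; exact hzero)

theorem paramOfValue_mem_orbit {c : ℝ} (hc : c ∈ ascentRange k x₀) :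
    paramOfValue k x₀ c ∈ orbit k x₀ :=
  Function.invFunOn_mem hc

theorem apply_paramOfValue {c : ℝ} (hc : c ∈ ascentRange k x₀) : k (paramOfValue k x₀ c) = c :=
  Function.invFunOn_eq hc

/-- The speed at which a value changes under gradient ascent is positive. -/
theorem norm_gradient_paramOfValue_pos (hk : ContDiff ℝ 2 k) (h0 : ∇ k x₀ ≠ 0) {c : ℝ}
    (hc : c ∈ ascentRange k x₀) : 0 < ‖∇ k (paramOfValue k x₀ c)‖ ^ 2 := by
  have := norm_pos_iff.2 (gradient_ne_zero_of_mem_orbit hk h0 (paramOfValue_mem_orbit hc))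
  positivity

/-- Along the maximal solution `Γ`, `(k ∘ Γ)' = ‖∇k(Γ)‖² > 0`, so `k ∘ Γ` is strictly increasing and
`paramOfValue` is `Γ ∘ (k ∘ Γ)⁻¹`; its derivative comes from the chain rule. -/
theorem ascentRange_isOpen_ordConnected_hasDerivAt (hk : ContDiff ℝ 2 k) (h0 : ∇ k x₀ ≠ 0) :
    IsOpen (ascentRange k x₀) ∧ OrdConnected (ascentRange k x₀) ∧
      ∀ c ∈ ascentRange k x₀, HasDerivAt (paramOfValue k x₀)
        ((‖∇ k (paramOfValue k x₀ c)‖ ^ 2)⁻¹ • ∇ k (paramOfValue k x₀ c)) c := by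
  obtain ⟨J, Γ, hJo, hJc, -, -, hΓ, horb⟩ := exists_maximal_gradientAscent hk x₀
  have hkd : Differentiable ℝ k := hk.differentiable (by norm_num)
  have hne : ∀ t ∈ J, 0 < ‖∇ k (Γ t)‖ ^ 2 := by
    intro t ht
    have := norm_pos_iff.2 (gradient_ne_zero_of_mem_orbit hk h0 (horb ▸ mem_image_of_mem Γ ht))
    positivity
  have hder : ∀ t ∈ J, HasDerivAt (k ∘ Γ) (‖∇ k (Γ t)‖ ^ 2) t := by
    intro t ht
    have := (hkd (Γ t)).hasFDerivAt.comp_hasDerivAt t (hΓ t ht)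
    rwa [← inner_gradient_left, real_inner_self_eq_norm_sq] at this
  -- Strict differentiability yields both that the range is open and that the inverse of `k ∘ Γ` is
  -- differentiable.
  have hstrict : ∀ t ∈ J, HasStrictDerivAt (k ∘ Γ) (‖∇ k (Γ t)‖ ^ 2) t := by
    intro t ht
    refine hasStrictDerivAt_of_hasDerivAt_of_continuousAt
      (f' := fun t => ‖∇ k (Γ t)‖ ^ 2) ?_ ?_
    · filter_upwards [hJo.mem_nhds ht] with s hs using hder s hs
    · have h1 : ContinuousAt (∇ k) (Γ t) := (contDiff_one_gradient hk).continuous.continuousAt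
      exact (ContinuousAt.comp h1 (hΓ t ht).continuousAt).norm.pow 2
  have hmono : StrictMonoOn (k ∘ Γ) J := by
    refine strictMonoOn_of_deriv_pos hJc.ordConnected.convex
      (fun t ht => (hder t ht).continuousAt.continuousWithinAt) fun t ht => ?_
    rw [(hder t (interior_subset ht)).deriv]
    exact hne t (interior_subset ht)
  have hrange : ascentRange k x₀ = (k ∘ Γ) '' J := by
    rw [ascentRange, horb, image_image]; rfl
  have hparam : ∀ t ∈ J, paramOfValue k x₀ (k (Γ t)) = Γ t := by
    intro t ht
    have hc : k (Γ t) ∈ ascentRange k x₀ := hrange ▸ mem_image_of_mem (k ∘ Γ) ht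
    have h1 := paramOfValue_mem_orbit hc
    rw [horb] at h1
    obtain ⟨s, hs, hs'⟩ := h1
    have h2 : (k ∘ Γ) s = (k ∘ Γ) t := by simp [hs', apply_paramOfValue hc]
    rw [← hs', hmono.injOn hs ht h2]
  have hopen : IsOpen (ascentRange k x₀) := by
    rw [hrange, isOpen_iff_mem_nhds]
    rintro _ ⟨t, ht, rfl⟩
    rw [← (hstrict t ht).map_nhds_eq (hne t ht).ne']
    exact image_mem_map (hJo.mem_nhds ht)
  refine ⟨hopen, ?_, ?_⟩
  · rw [hrange]
    exact (hJc.image _ fun t ht => (hder t ht).continuousAt.continuousWithinAt).ordConnected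
  · intro c hc
    obtain ⟨t, ht, rfl⟩ := hrange ▸ hc
    have hinv : ∀ s ∈ J, Function.invFunOn (k ∘ Γ) J ((k ∘ Γ) s) = s :=
      fun s hs => hmono.injOn.leftInvOn_invFunOn hs
    have h1 := ((hstrict t ht).to_local_left_inverse (hne t ht).ne'
      (g := Function.invFunOn (k ∘ Γ) J)
      (by filter_upwards [hJo.mem_nhds ht] with s hs using hinv s hs)).hasDerivAt
    have h2 : HasDerivAt Γ (∇ k (Γ t)) (Function.invFunOn (k ∘ Γ) J ((k ∘ Γ) t)) := by
      rw [hinv t ht]; exact hΓ t ht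
    have h3 := h2.scomp _ h1
    have h4 : paramOfValue k x₀ ((k ∘ Γ) t) = Γ t := hparam t ht
    rw [h4]
    refine h3.congr_of_eventuallyEq ?_
    filter_upwards [hopen.mem_nhds hc] with c' hc'
    obtain ⟨s, hs, rfl⟩ := hrange ▸ hc'
    exact (hparam s hs).trans (congrArg Γ (hinv s hs).symm)

theorem isOpen_ascentRange (hk : ContDiff ℝ 2 k) (h0 : ∇ k x₀ ≠ 0) : IsOpen (ascentRange k x₀) :=
  (ascentRange_isOpen_ordConnected_hasDerivAt hk h0).1

theorem ordConnected_ascentRange (hk : ContDiff ℝ 2 k) (h0 : ∇ k x₀ ≠ 0) :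
    OrdConnected (ascentRange k x₀) :=
  (ascentRange_isOpen_ordConnected_hasDerivAt hk h0).2.1

theorem contDiffOn_norm_gradient_paramOfValue (hk : ContDiff ℝ 2 k) (h0 : ∇ k x₀ ≠ 0) :
    ContDiffOn ℝ 1 (fun c => ‖∇ k (paramOfValue k x₀ c)‖ ^ 2) (ascentRange k x₀) := by
  obtain ⟨ho, -, hd⟩ := ascentRange_isOpen_ordConnected_hasDerivAt hk h0
  have hv := contDiff_one_gradient hk
  have hX : ContinuousOn (paramOfValue k x₀) (ascentRange k x₀) :=
    fun c hc => (hd c hc).continuousAt.continuousWithinAt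
  have hgX : ContinuousOn (fun c => ∇ k (paramOfValue k x₀ c)) (ascentRange k x₀) :=
    hv.continuous.comp_continuousOn hX
  -- Bootstrap: the formula for the derivative of `paramOfValue` involves only `paramOfValue`
  -- itself, already known to be continuous.
  have hX1 : ContDiffOn ℝ 1 (paramOfValue k x₀) (ascentRange k x₀) := by
    rw [← zero_add (1 : WithTop ℕ∞), contDiffOn_succ_iff_deriv_of_isOpen ho]
    refine ⟨fun c hc => (hd c hc).differentiableAt.differentiableWithinAt, by simp, ?_⟩
    rw [contDiffOn_zero]
    refine ContinuousOn.congr (f := fun c => (‖∇ k (paramOfValue k x₀ c)‖ ^ 2)⁻¹ •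
      ∇ k (paramOfValue k x₀ c)) ?_ fun c hc => (hd c hc).deriv
    exact ((hgX.norm.pow 2).inv₀ fun c hc => (norm_gradient_paramOfValue_pos hk h0 hc).ne').smul hgX
  exact (hv.comp_contDiffOn hX1).norm_sq ℝ

end Orbit

/-! ### Barbalat's lemma and global existence -/

/-- **Barbalat's lemma**: if a function converges and its derivative is uniformly continuous, then
the derivative tends to zero. -/
theorem tendsto_zero_of_uniformContinuousOn_deriv {ψ ψ' : ℝ → ℝ} {l : ℝ}
    (hd : ∀ t, 0 ≤ t → HasDerivWithinAt ψ (ψ' t) (Ici 0) t)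
    (hu : UniformContinuousOn ψ' (Ici 0)) (hl : Tendsto ψ atTop (𝓝 l)) :
    Tendsto ψ' atTop (𝓝 0) := by
  rw [Metric.tendsto_atTop]
  intro ε hε
  obtain ⟨δ, hδ, hδu⟩ := Metric.uniformContinuousOn_iff.1 hu (ε / 2) (half_pos hε)
  -- Mean slopes over windows of length `δ / 2` tend to zero; each equals `ψ'` at a point of the
  -- window, where `ψ'` differs from `ψ' t` by less than `ε / 2`.
  have hdiff : Tendsto (fun t => (ψ (t + δ / 2) - ψ t) / (t + δ / 2 - t)) atTop (𝓝 0) := by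
    have h1 : Tendsto (fun t => ψ (t + δ / 2)) atTop (𝓝 l) :=
      hl.comp (tendsto_atTop_add_const_right _ _ tendsto_id)
    simpa using (h1.sub hl).div_const (δ / 2)
  obtain ⟨N, hN⟩ := Metric.tendsto_atTop.1 hdiff (ε / 2) (half_pos hε)
  refine ⟨max N 0, fun t ht => ?_⟩
  have ht0 : 0 ≤ t := (le_max_right _ _).trans ht
  obtain ⟨c, hc, hc'⟩ := exists_hasDerivAt_eq_slope ψ ψ' (show t < t + δ / 2 by linarith)
    (fun s hs => ((hd s (ht0.trans hs.1)).continuousWithinAt).mono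
      fun r hr => ht0.trans hr.1)
    fun s hs => (hd s (ht0.trans hs.1.le)).hasDerivAt (Ici_mem_nhds (ht0.trans_lt hs.1))
  have h1 := hN t ((le_max_left _ _).trans ht)
  rw [← hc'] at h1
  have h2 := hδu t ht0 c (ht0.trans hc.1.le)
    (by rw [Real.dist_eq, abs_sub_lt_iff]; constructor <;> linarith [hc.1, hc.2])
  linarith [dist_triangle (ψ' t) (ψ' c) 0]

/-- A bounded, globally Lipschitz vector field has global solutions. -/
theorem exists_global_solution {E : Type*} [NormedAddCommGroup E] [NormedSpace ℝ E]
    [CompleteSpace E] {v : E → E} {K M : NNReal} (hv : LipschitzWith K v) (hM : ∀ x, ‖v x‖ ≤ M)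
    (x₀ : E) : ∃ z : ℝ → E, z 0 = x₀ ∧ ∀ t, HasDerivAt z (v (z t)) t := by
  have hloc : ∀ T : ℝ, 0 < T → ∃ z : ℝ → E, z 0 = x₀ ∧
      ∀ t ∈ Ioo (-T) T, HasDerivAt z (v (z t)) t := by
    intro T hT
    -- With speed at most `M`, a solution stays within `M T` of `x₀` up to time `T`, so `T` is
    -- unrestricted.
    have hpl : IsPicardLindelof (fun _ => v) (tmin := -T) (tmax := T) ⟨0, by simp [hT.le]⟩ x₀
        (M * T.toNNReal) 0 M K :=
      { lipschitzOnWith := fun _ _ => hv.lipschitzOnWith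
        continuousOn := fun _ _ => continuousOn_const
        norm_le := fun _ _ x _ => hM x
        mul_max_le := by simp [hT.le] }
    obtain ⟨z, hz0, hz⟩ := hpl.exists_eq_forall_mem_Icc_hasDerivWithinAt₀
    exact ⟨z, hz0, fun t ht =>
      (hz t (Ioo_subset_Icc_self ht)).hasDerivAt (Icc_mem_nhds ht.1 ht.2)⟩
  choose! z hz0 hz using hloc
  have key : ∀ S T : ℝ, 0 < S → 0 < T → ∀ t, |t| < S → |t| < T → z S t = z T t := by
    intro S T hS hT t htS htT
    have h0 : 0 < min S T := lt_min hS hT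
    refine ODE_solution_unique_of_mem_Ioo (v := fun _ => v) (s := fun _ => univ) (t₀ := 0)
      (a := -min S T) (b := min S T)
      (fun _ _ => hv.lipschitzOnWith) ⟨by linarith, h0⟩ (fun s hs => ⟨hz S hS s ?_, trivial⟩)
      (fun s hs => ⟨hz T hT s ?_, trivial⟩) ((hz0 S hS).trans (hz0 T hT).symm)
      (abs_lt.1 (lt_min htS htT))
    · exact abs_lt.1 ((abs_lt.2 hs).trans_le (min_le_left _ _))
    · exact abs_lt.1 ((abs_lt.2 hs).trans_le (min_le_right _ _))
  refine ⟨fun t => z (|t| + 1) t, hz0 _ (by positivity), fun t => ?_⟩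
  have hT : 0 < |t| + 1 := by positivity
  refine (hz (|t| + 1) hT t (abs_lt.1 (lt_add_one _))).congr_of_eventuallyEq ?_
  filter_upwards [continuous_abs.continuousAt.eventually_lt continuousAt_const
    (lt_add_one |t|)] with s hs
  exact key _ _ (by positivity) hT s (lt_add_one _) hs

/-! ### Separable Lyapunov functions -/

/-- The potential is the integral of `a` from `p`; the sign condition makes it strictly decreasing
left of `p` and strictly increasing right of it, so small sublevel sets are close to `p`. -/
theorem exists_potential {I : Set ℝ} (ho : IsOpen I) (hc : OrdConnected I) {a : ℝ → ℝ}
    (ha : ContinuousOn a I) {p : ℝ} (hp : p ∈ I) (hsgn : ∀ c ∈ I, c ≠ p → 0 < (c - p) * a c) :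
    ∃ h : ℝ → ℝ, (∀ c ∈ I, HasDerivAt h (a c) c) ∧ h p = 0 ∧ (∀ c ∈ I, 0 ≤ h c) ∧
      ∀ δ > 0, p - δ ∈ I → p + δ ∈ I → ∃ η > 0, ∀ c ∈ I, h c < η → |c - p| < δ := by
  have hd : ∀ c ∈ I, HasDerivAt (fun c => ∫ s in p..c, a s) (a c) c := by
    intro c hcI
    exact intervalIntegral.integral_hasDerivAt_right
      ((ha.mono (hc.uIcc_subset hp hcI)).intervalIntegrable)
      (ha.stronglyMeasurableAtFilter ho c hcI) (ha.continuousAt (ho.mem_nhds hcI))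
  have hcont : ContinuousOn (fun c => ∫ s in p..c, a s) I :=
    fun c hcI => (hd c hcI).continuousAt.continuousWithinAt
  have h0 : (∫ s in p..p, a s) = 0 := intervalIntegral.integral_same
  have hmono : StrictMonoOn (fun c => ∫ s in p..c, a s) (I ∩ Ici p) := by
    refine strictMonoOn_of_deriv_pos (hc.convex.inter (convex_Ici p)) (hcont.mono inter_subset_left)
      fun c hcI => ?_
    rw [interior_inter, interior_Ici] at hcI
    have hcI' := interior_subset hcI.1
    rw [(hd c hcI').deriv]
    exact (pos_iff_pos_of_mul_pos (hsgn c hcI' (ne_of_gt hcI.2))).1 (sub_pos.2 hcI.2)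
  have hanti : StrictAntiOn (fun c => ∫ s in p..c, a s) (I ∩ Iic p) := by
    refine strictAntiOn_of_deriv_neg (hc.convex.inter (convex_Iic p)) (hcont.mono inter_subset_left)
      fun c hcI => ?_
    rw [interior_inter, interior_Iic] at hcI
    have hcI' := interior_subset hcI.1
    rw [(hd c hcI').deriv]
    exact (neg_iff_neg_of_mul_pos (hsgn c hcI' (ne_of_lt hcI.2))).1 (sub_neg.2 hcI.2)
  refine ⟨fun c => ∫ s in p..c, a s, hd, h0, fun c hcI => ?_, fun δ hδ h1 h2 => ?_⟩
  · rw [← h0]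
    rcases le_total p c with h | h
    · exact hmono.monotoneOn ⟨hp, le_refl p⟩ ⟨hcI, h⟩ h
    · exact hanti.antitoneOn ⟨hcI, h⟩ ⟨hp, le_refl p⟩ h
  · have hl : p - δ ≤ p := by linarith
    have hr : p ≤ p + δ := by linarith
    refine ⟨min (∫ s in p..(p - δ), a s) (∫ s in p..(p + δ), a s), lt_min ?_ ?_, fun c hcI hlt => ?_⟩
    · simpa only [h0] using hanti ⟨h1, hl⟩ ⟨hp, le_refl p⟩ (by linarith)
    · simpa only [h0] using hmono ⟨hp, le_refl p⟩ ⟨h2, hr⟩ (by linarith)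
    · by_contra! hcon
      rcases le_abs.1 hcon with h | h
      · have := hmono.monotoneOn ⟨h2, hr⟩ ⟨hcI, (by linarith : p ≤ c)⟩ (by linarith)
        exact absurd (hlt.trans_le (min_le_right _ _)) (not_lt.2 this)
      · have := hanti.antitoneOn ⟨hcI, (by linarith : c ≤ p)⟩ ⟨h1, hl⟩ (by linarith)
        exact absurd (hlt.trans_le (min_le_left _ _)) (not_lt.2 this)

theorem exists_tendsto_of_hasDerivWithinAt_nonpos {ψ ψ' : ℝ → ℝ}
    (hd : ∀ t, 0 ≤ t → HasDerivWithinAt ψ (ψ' t) (Ici 0) t) (hψ' : ∀ t, 0 ≤ t → ψ' t ≤ 0)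
    (h0 : ∀ t, 0 ≤ t → 0 ≤ ψ t) :
    AntitoneOn ψ (Ici 0) ∧ ∃ l, Tendsto ψ atTop (𝓝 l) := by
  have hanti : AntitoneOn ψ (Ici 0) := by
    refine antitoneOn_of_deriv_nonpos (convex_Ici 0) (fun t ht => (hd t ht).continuousWithinAt)
      (fun t ht => ?_) fun t ht => ?_
    all_goals
      rw [interior_Ici] at ht
      have := (hd t (le_of_lt ht)).hasDerivAt (Ici_mem_nhds ht)
    · exact this.differentiableAt.differentiableWithinAt
    · rw [this.deriv]; exact hψ' t (le_of_lt ht)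
  refine ⟨hanti, ⨅ t, ψ (max 0 t), ?_⟩
  have h1 : Antitone fun t => ψ (max 0 t) := fun s t hst =>
    hanti (le_max_left 0 s) (le_max_left 0 t) (max_le_max_left 0 hst)
  refine (tendsto_atTop_ciInf h1 ⟨0, ?_⟩).congr' ?_
  · rintro _ ⟨t, rfl⟩
    exact h0 _ (le_max_left 0 t)
  · filter_upwards [eventually_ge_atTop 0] with t ht
    rw [max_eq_right ht]

/-- The product of the intervals `[pᵢ - δ, pᵢ + δ]`. -/
abbrev box {ι : Type*} (p : ι → ℝ) (δ : ℝ) : Set (ι → ℝ) := Icc (fun i => p i - δ) (fun i => p i + δ)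

theorem mem_of_mem_box {ι : Type*} {I : ι → Set ℝ} {p : ι → ℝ} {δ : ℝ}
    (hI : ∀ i, Icc (p i - δ) (p i + δ) ⊆ I i) {w : ι → ℝ} (hw : w ∈ box p δ) (i : ι) : w i ∈ I i :=
  hI i ⟨hw.1 i, hw.2 i⟩

section Dynamics

variable {ι : Type*} [Fintype ι] {I : ι → Set ℝ} {p : ι → ℝ}

/-- Curves along which a separable Lyapunov function `∑ i, hᵢ` with `hᵢ' = aᵢ` decreases stay close
to its minimum point `p`, and the Lyapunov function converges along them. -/
theorem exists_nhds_forall_abs_sub_lt (ho : ∀ i, IsOpen (I i)) (hc : ∀ i, OrdConnected (I i))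
    {a : ι → ℝ → ℝ} (ha : ∀ i, ContinuousOn (a i) (I i)) (hp : ∀ i, p i ∈ I i)
    (hsgn : ∀ i, ∀ c ∈ I i, c ≠ p i → 0 < (c - p i) * a i c) {δ : ℝ} (hδ : 0 < δ)
    (hl : ∀ i, p i - δ ∈ I i) (hr : ∀ i, p i + δ ∈ I i) :
    ∃ U ∈ 𝓝 p, ∀ z v : ℝ → ι → ℝ, (∀ t, 0 ≤ t → ∀ i, z t i ∈ I i) →
      (∀ t, 0 ≤ t → ∀ i, HasDerivWithinAt (fun s => z s i) (v t i) (Ici 0) t) →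
      (∀ t, 0 ≤ t → ∑ i, a i (z t i) * v t i ≤ 0) → z 0 ∈ U →
      (∀ t, 0 ≤ t → ∀ i, |z t i - p i| < δ) ∧
      ∃ (ψ : ℝ → ℝ) (l : ℝ),
        (∀ t, 0 ≤ t → HasDerivWithinAt ψ (∑ i, a i (z t i) * v t i) (Ici 0) t) ∧
          Tendsto ψ atTop (𝓝 l) := by
  choose h hd h0 hnn hη using fun i => exists_potential (ho i) (hc i) (ha i) (hp i) (hsgn i)
  choose η hηpos hη using fun i => hη i δ hδ (hl i) (hr i)
  -- The index type may be empty, so `m` is found as a sufficiently small positive number rather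
  -- than as a minimum.
  obtain ⟨m, hm, hm0⟩ : ∃ m, (∀ i, m ≤ η i) ∧ 0 < m := by
    have : ∀ᶠ m in 𝓝[>] (0 : ℝ), ∀ i, m ≤ η i := eventually_all.2 fun i =>
      nhdsWithin_le_nhds ((eventually_lt_nhds (hηpos i)).mono fun _ => le_of_lt)
    exact (this.and self_mem_nhdsWithin).exists
  have hcontp : ContinuousAt (fun w : ι → ℝ => ∑ i, h i (w i)) p :=
    tendsto_finsetSum _ fun i _ =>
      ContinuousAt.comp (hd i (p i) (hp i)).continuousAt (continuous_apply i).continuousAt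
  refine ⟨{w | ∑ i, h i (w i) < m}, hcontp.eventually_lt continuousAt_const (by simpa [h0]), ?_⟩
  intro z v hzI hzv hdec hz0
  have hder : ∀ t, 0 ≤ t → HasDerivWithinAt (fun s => ∑ i, h i (z s i))
      (∑ i, a i (z t i) * v t i) (Ici 0) t := fun t ht =>
    HasDerivWithinAt.fun_sum fun i _ =>
      (hd i (z t i) (hzI t ht i)).comp_hasDerivWithinAt t (hzv t ht i)
  obtain ⟨hanti, l, hlim⟩ := exists_tendsto_of_hasDerivWithinAt_nonpos hder hdec
    fun t ht => Finset.sum_nonneg fun i _ => hnn i _ (hzI t ht i)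
  refine ⟨fun t ht i => hη i _ (hzI t ht i) ?_, _, l, hder, hlim⟩
  calc h i (z t i) ≤ ∑ j, h j (z t j) :=
        Finset.single_le_sum (f := fun j => h j (z t j)) (fun j _ => hnn j _ (hzI t ht j))
          (Finset.mem_univ i)
    _ ≤ ∑ j, h j (z 0 j) := hanti (mem_Ici.2 le_rfl) ht ht
    _ < m := hz0
    _ ≤ η i := hm i

/-- The trajectories `zᵢ' = ρᵢ(zᵢ) Φᵢ(z)`, for all times `t ≥ 0`, in the product of the sets
`I i`. -/
def IsSeparableTrajectory (I : ι → Set ℝ) (ρ : ι → ℝ → ℝ) (Φ : (ι → ℝ) → ι → ℝ)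
    (z : ℝ → ι → ℝ) : Prop :=
  ∀ t, 0 ≤ t → ∀ i, z t i ∈ I i ∧
    HasDerivWithinAt (fun s => z s i) (ρ i (z t i) * Φ (z t) i) (Ici 0) t

variable {ρ : ι → ℝ → ℝ} {Φ : (ι → ℝ) → ι → ℝ} {δ : ℝ}

theorem contDiffOn_separableField (hρ : ∀ i, ContDiffOn ℝ 1 (ρ i) (I i)) (hΦ : ContDiff ℝ 1 Φ)
    (hI : ∀ i, Icc (p i - δ) (p i + δ) ⊆ I i) :
    ContDiffOn ℝ 1 (fun w i => ρ i (w i) * Φ w i) (box p δ) := by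
  rw [contDiffOn_pi]
  intro i
  exact ((hρ i).comp (contDiff_apply ℝ ℝ i).contDiffOn fun w hw => mem_of_mem_box hI hw i).mul
    ((contDiff_apply ℝ ℝ i).comp hΦ).contDiffOn

/-- Composing the field with the projection onto the box makes it bounded and globally Lipschitz. A
Lyapunov function for the truncated field keeps its solutions inside the box, where the truncation
has no effect. -/
theorem exists_separableTrajectory (hρ : ∀ i, ContDiffOn ℝ 1 (ρ i) (I i))
    (hpos : ∀ i, ∀ c ∈ I i, 0 < ρ i c) (hΦ : ContDiff ℝ 1 Φ)
    (hdec : ∀ w, ∑ i, (w i - p i) * Φ w i ≤ 0) (hδ : 0 < δ)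
    (hI : ∀ i, Icc (p i - δ) (p i + δ) ⊆ I i) :
    ∃ U ∈ 𝓝 p, ∀ x₀ ∈ U, ∃ z, IsSeparableTrajectory I ρ Φ z ∧ z 0 = x₀ := by
  have hle : ∀ i, p i - δ ≤ p i + δ := fun i => by linarith
  let cl : ι → ℝ → ℝ := fun i c => projIcc (p i - δ) (p i + δ) (hle i) c
  have hclI : ∀ i c, cl i c ∈ Icc (p i - δ) (p i + δ) := fun i c => (projIcc _ _ (hle i) c).2
  have hcll : ∀ i, LipschitzWith 1 (cl i) := fun i => LipschitzWith.projIcc (hle i)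
  have hcl : ∀ i c, c ∈ Icc (p i - δ) (p i + δ) → cl i c = c :=
    fun i c hc => congrArg Subtype.val (projIcc_of_mem (hle i) hc)
  let CL : (ι → ℝ) → ι → ℝ := fun w i => cl i (w i)
  have hCLl : LipschitzWith 1 CL := by
    refine LipschitzWith.of_dist_le_mul fun w w' => ?_
    rw [dist_pi_le_iff (by positivity)]
    intro i
    exact ((hcll i).dist_le_mul _ _).trans (by gcongr; exact dist_le_pi_dist w w' i)
  have hCLm : ∀ w, CL w ∈ box p δ := fun w =>
    ⟨fun i => (hclI i (w i)).1, fun i => (hclI i (w i)).2⟩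
  have hV := contDiffOn_separableField hρ hΦ hI
  obtain ⟨K, hK⟩ := hV.exists_lipschitzOnWith one_ne_zero (convex_Icc _ _) isCompact_Icc
  obtain ⟨M, hM⟩ := isCompact_Icc.exists_bound_of_continuousOn hV.continuousOn
  have hlip : LipschitzWith (K * 1) fun w => (fun i => ρ i (CL w i) * Φ (CL w) i) := by
    rw [← lipschitzOnWith_univ]
    exact hK.comp hCLl.lipschitzOnWith fun w _ => hCLm w
  have hρcl : ∀ i c, 0 < ρ i (cl i c) := fun i c => hpos i _ (hI i (hclI i c))
  -- The density is truncated like the field, so `V'` is the pairing of `hdec` evaluated at the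
  -- projected point.
  obtain ⟨U, hU, hUz⟩ := exists_nhds_forall_abs_sub_lt (I := fun _ => univ) (p := p)
    (a := fun i c => (cl i c - p i) / ρ i (cl i c)) (fun _ => isOpen_univ) (fun _ => ordConnected_univ)
    (fun i => (((hcll i).continuous.sub continuous_const).continuousOn.div
      ((hρ i).continuousOn.comp (hcll i).continuous.continuousOn fun c _ => hI i (hclI i c))
      fun c _ => (hρcl i c).ne'))
    (fun _ => trivial) (fun i c _ hc => by
      rw [mul_div_assoc']
      refine div_pos ?_ (hρcl i c)
      have h1 : cl i c = max (p i - δ) (min (p i + δ) c) := rfl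
      rcases lt_or_gt_of_ne hc with h | h
      · refine mul_pos_of_neg_of_neg (by linarith) ?_
        rw [h1, sub_neg]
        exact max_lt (by linarith) ((min_le_right _ _).trans_lt h)
      · refine mul_pos (by linarith) ?_
        rw [h1, sub_pos]
        exact lt_max_of_lt_right (lt_min (by linarith) h))
    hδ (fun _ => trivial) (fun _ => trivial)
  refine ⟨U, hU, fun x₀ hx₀ => ?_⟩
  obtain ⟨z, hz0, hz⟩ := exists_global_solution (M := M.toNNReal) hlip
    (fun w => (hM _ (hCLm w)).trans (Real.le_coe_toNNReal M)) x₀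
  have hzi : ∀ t i, HasDerivAt (fun s => z s i) (ρ i (CL (z t) i) * Φ (CL (z t)) i) t :=
    fun t i => hasDerivAt_pi.1 (hz t) i
  have hbox := (hUz z (fun t i => ρ i (CL (z t) i) * Φ (CL (z t)) i) (fun _ _ _ => trivial)
    (fun t _ i => (hzi t i).hasDerivWithinAt) (fun t _ => by
      refine (Finset.sum_congr rfl fun i _ => ?_).trans_le (hdec (CL (z t)))
      have := (hρcl i (z t i)).ne'
      change (cl i (z t i) - p i) / ρ i (cl i (z t i)) * (ρ i (cl i (z t i)) * _) =
        (cl i (z t i) - p i) * _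
      field_simp) (hz0 ▸ hx₀)).1
  refine ⟨z, fun t ht => ?_, hz0⟩
  have hmem : ∀ i, z t i ∈ Icc (p i - δ) (p i + δ) := fun i => by
    have := abs_lt.1 (hbox t ht i)
    constructor <;> linarith
  have hCLz : CL (z t) = z t := funext fun i => hcl i _ (hmem i)
  refine fun i => ⟨hI i (hmem i), ?_⟩
  have := (hzi t i).hasDerivWithinAt (s := Ici 0)
  rwa [hCLz] at this

/-- Barbalat's lemma is used twice: for the Lyapunov function, and for a single coordinate known to
converge to `pᵢ`, where the factor `ρᵢ(pᵢ) > 0` can be divided out. -/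
theorem IsSeparableTrajectory.tendsto (ho : ∀ i, IsOpen (I i)) (hc : ∀ i, OrdConnected (I i))
    (hρ : ∀ i, ContDiffOn ℝ 1 (ρ i) (I i))
    (hpos : ∀ i, ∀ c ∈ I i, 0 < ρ i c) (hΦ : ContDiff ℝ 1 Φ)
    (hdec : ∀ w, ∑ i, (w i - p i) * Φ w i ≤ 0) (hδ : 0 < δ)
    (hI : ∀ i, Icc (p i - δ) (p i + δ) ⊆ I i) :
    ∃ U ∈ 𝓝 p, ∀ z, IsSeparableTrajectory I ρ Φ z → z 0 ∈ U →
      (∀ t, 0 ≤ t → z t ∈ box p δ) ∧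
      Tendsto (fun t => ∑ i, (z t i - p i) * Φ (z t) i) atTop (𝓝 0) ∧
      ∀ i, Tendsto (fun t => z t i) atTop (𝓝 (p i)) →
        Tendsto (fun t => Φ (z t) i) atTop (𝓝 0) := by
  have hmemp : ∀ i, p i ∈ I i := fun i => hI i ⟨by linarith, by linarith⟩
  obtain ⟨U, hU, hUz⟩ := exists_nhds_forall_abs_sub_lt ho hc (p := p)
    (a := fun i c => (c - p i) / ρ i c)
    (fun i => (continuous_id.sub continuous_const).continuousOn.div (hρ i).continuousOn
      fun c hcI => (hpos i c hcI).ne') hmemp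
    (fun i c hcI hne => by
      rw [mul_div_assoc']
      exact div_pos (mul_self_pos.2 (sub_ne_zero.2 hne)) (hpos i c hcI))
    hδ (fun i => hI i ⟨le_rfl, by linarith⟩) (fun i => hI i ⟨by linarith, le_rfl⟩)
  refine ⟨U, hU, fun z hz hz0 => ?_⟩
  have hsum : ∀ t, 0 ≤ t → ∑ i, (z t i - p i) / ρ i (z t i) * (ρ i (z t i) * Φ (z t) i) =
      ∑ i, (z t i - p i) * Φ (z t) i := fun t ht => Finset.sum_congr rfl fun i _ => by
    have := (hpos i _ (hz t ht i).1).ne'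
    field_simp
  obtain ⟨hbox, ψ, l, hψ, hψl⟩ := hUz z (fun t i => ρ i (z t i) * Φ (z t) i)
    (fun t ht i => (hz t ht i).1) (fun t ht i => (hz t ht i).2)
    (fun t ht => (hsum t ht).trans_le (hdec _)) hz0
  have hmem : ∀ t, 0 ≤ t → z t ∈ box p δ := fun t ht => by
    constructor <;> intro i <;> have := abs_lt.1 (hbox t ht i) <;> simp only <;> linarith
  have hV := contDiffOn_separableField hρ hΦ hI
  obtain ⟨M, hM⟩ := isCompact_Icc.exists_bound_of_continuousOn hV.continuousOn
  -- In the box the velocity is bounded, so `z` is Lipschitz and continuous functions of `z` are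
  -- uniformly continuous in time, as Barbalat's lemma requires.
  have hzu : UniformContinuousOn z (Ici 0) := by
    refine ((convex_Ici 0).lipschitzOnWith_of_nnnorm_hasDerivWithin_le (C := M.toNNReal)
      (f' := fun t i => ρ i (z t i) * Φ (z t) i)
      (fun t ht => hasDerivWithinAt_pi.2 fun i => (hz t ht i).2) fun t ht => ?_).uniformContinuousOn
    rw [← NNReal.coe_le_coe, coe_nnnorm]
    exact (hM _ (hmem t ht)).trans (Real.le_coe_toNNReal M)
  have hcomp : ∀ W : (ι → ℝ) → ℝ, ContinuousOn W (box p δ) →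
      UniformContinuousOn (fun t => W (z t)) (Ici 0) := fun W hW =>
    (isCompact_Icc.uniformContinuousOn_of_continuous hW).comp hzu hmem
  have hΦi : ∀ i, Continuous fun w => Φ w i := fun i => (continuous_apply i).comp hΦ.continuous
  refine ⟨hmem, ?_, fun i hi => ?_⟩
  · have hW : Continuous fun w => ∑ i, (w i - p i) * Φ w i := continuous_finsetSum _ fun i _ =>
      ((continuous_apply i).sub continuous_const).mul (hΦi i)
    refine tendsto_zero_of_uniformContinuousOn_deriv (fun t ht => ?_)
      (hcomp _ hW.continuousOn) hψl
    rw [← hsum t ht]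
    exact hψ t ht
  · have h1 := tendsto_zero_of_uniformContinuousOn_deriv (fun t ht => (hz t ht i).2)
      (hcomp (fun w => ρ i (w i) * Φ w i) (continuousOn_pi.1 hV.continuousOn i)) hi
    have h2 : Tendsto (fun t => ρ i (z t i)) atTop (𝓝 (ρ i (p i))) :=
      ((hρ i).continuousOn.continuousAt ((ho i).mem_nhds (hmemp i))).tendsto.comp hi
    have h3 := h1.div h2 (hpos i _ (hmemp i)).ne'
    rw [zero_div] at h3
    refine h3.congr' ?_
    filter_upwards [eventually_ge_atTop 0] with t ht
    exact mul_div_cancel_left₀ _ (hpos i _ (hz t ht i).1).ne'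

end Dynamics

/-! ### Convex-concave functions -/

theorem _root_.ConvexOn.sum_mul_gradient_le {d : ℕ} {k : Vec d → ℝ} (hk : ConvexOn ℝ univ k)
    {x : Vec d} (hx : DifferentiableAt ℝ k x) (y : Vec d) :
    ∑ i, (y i - x i) * ∇ k x i ≤ k y - k x := by
  have h1 : HasDerivAt (k ∘ AffineMap.lineMap x y) (inner ℝ (∇ k x) (y - x)) (0 : ℝ) := by
    rw [inner_gradient_left]
    refine HasFDerivAt.comp_hasDerivAt (0 : ℝ) ?_ AffineMap.hasDerivAt_lineMap
    simpa using hx.hasFDerivAt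
  have h2 := (hk.comp_affineMap (AffineMap.lineMap (k := ℝ) x y)).le_slope_of_hasDerivAt
    (mem_univ (0 : ℝ)) (mem_univ 1) one_pos h1
  have h3 : inner ℝ (∇ k x) (y - x) = ∑ i, (y i - x i) * ∇ k x i := by
    rw [PiLp.inner_apply]
    rfl
  rw [h3] at h2
  simpa [slope_def_field] using h2

theorem _root_.ConcaveOn.le_sum_mul_gradient {d : ℕ} {k : Vec d → ℝ} (hk : ConcaveOn ℝ univ k)
    {x : Vec d} (hx : DifferentiableAt ℝ k x) (y : Vec d) :
    k y - k x ≤ ∑ i, (y i - x i) * ∇ k x i := by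
  have h1 : ∇ (-k) x = -∇ k x := by simp [gradient, fderiv_neg]
  have h2 := hk.neg.sum_mul_gradient_le hx.neg y
  simp only [h1, PiLp.neg_apply, mul_neg, Finset.sum_neg_distrib, Pi.neg_apply] at h2
  linarith

section Saddle

variable {n m : ℕ} {L : Vec n → Vec m → ℝ}

theorem differentiable_left (hL : ContDiff ℝ 2 (fun w : Vec n × Vec m => L w.1 w.2)) (y : Vec m) :
    Differentiable ℝ fun x => L x y :=
  (hL.comp (contDiff_id.prodMk contDiff_const)).differentiable (by norm_num)

theorem differentiable_right (hL : ContDiff ℝ 2 (fun w : Vec n × Vec m => L w.1 w.2))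
    (x : Vec n) : Differentiable ℝ fun y => L x y :=
  (hL.comp (contDiff_const.prodMk contDiff_id)).differentiable (by norm_num)

/-- The displacement of `(x, y)` from `(p, q)`, paired with the descent-ascent direction. -/
noncomputable def descentAscentPairing (L : Vec n → Vec m → ℝ) (p x : Vec n) (q y : Vec m) : ℝ :=
  ∑ i, (x i - p i) * -∇ (fun x => L x y) x i + ∑ j, (y j - q j) * ∇ (fun y => L x y) y j

/-- Add the gradient inequalities at `(x, y)` towards `p` and `q`; the terms `L x y` cancel. -/
theorem descentAscentPairing_le (hL : ContDiff ℝ 2 (fun w : Vec n × Vec m => L w.1 w.2))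
    (hcc : IsConvexConcave L) (p x : Vec n) (q y : Vec m) :
    descentAscentPairing L p x q y ≤ L p y - L x q := by
  have h1 := (hcc.1 y).sum_mul_gradient_le (differentiable_left hL y x) p
  have h2 := (hcc.2 x).le_sum_mul_gradient (differentiable_right hL x y) q
  have h3 : ∑ i, (x i - p i) * -∇ (fun x => L x y) x i =
      ∑ i, (p i - x i) * ∇ (fun x => L x y) x i :=
    Finset.sum_congr rfl fun i _ => by ring
  have h4 : ∑ j, (y j - q j) * ∇ (fun y => L x y) y j =
      -∑ j, (q j - y j) * ∇ (fun y => L x y) y j := by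
    rw [← Finset.sum_neg_distrib]
    exact Finset.sum_congr rfl fun j _ => by ring
  rw [descentAscentPairing, h3, h4]
  linarith

theorem values_eq_of_pairing_nonneg (hL : ContDiff ℝ 2 (fun w : Vec n × Vec m => L w.1 w.2))
    (hcc : IsConvexConcave L) {z w : OutputSpace n m} (hz : z ∈ Solution L)
    (h : 0 ≤ descentAscentPairing L z.fst w.fst z.snd w.snd) :
    L z.fst w.snd = L z.fst z.snd ∧ L w.fst z.snd = L z.fst z.snd := by
  have h1 := descentAscentPairing_le hL hcc z.fst w.fst z.snd w.snd
  have h2 := hz.1 w.snd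
  have h3 := hz.2 w.fst
  constructor <;> linarith

theorem fst_eq_of_strictConvexOn {z w : OutputSpace n m} (hz : z ∈ Solution L)
    (hs : StrictConvexOn ℝ univ fun x => L x z.snd) (h : L w.fst z.snd = L z.fst z.snd) :
    w.fst = z.fst :=
  hs.eq_of_isMinOn (fun x _ => h.trans_le (hz.2 x)) (fun x _ => hz.2 x) trivial trivial

theorem snd_eq_of_strictConcaveOn {z w : OutputSpace n m} (hz : z ∈ Solution L)
    (hs : StrictConcaveOn ℝ univ fun y => L z.fst y) (h : L z.fst w.snd = L z.fst z.snd) :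
    w.snd = z.snd :=
  hs.eq_of_isMaxOn (fun y _ => (hz.1 y).trans_eq h.symm) (fun y _ => hz.1 y) trivial trivial

/-- Equal values make `w.snd` a maximizer against the common first block; the vanishing gradient and
convexity make `w.fst` a minimizer. -/
theorem mem_solution_of_fst_eq (hL : ContDiff ℝ 2 (fun w : Vec n × Vec m => L w.1 w.2))
    (hcc : IsConvexConcave L) {z w : OutputSpace n m} (hz : z ∈ Solution L)
    (hfst : w.fst = z.fst) (h : L z.fst w.snd = L z.fst z.snd)
    (hgrad : ∀ i, ∇ (fun x => L x w.snd) w.fst i = 0) : w ∈ Solution L := by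
  refine ⟨fun y => by rw [hfst, h]; exact hz.1 y, fun x => ?_⟩
  have := (hcc.1 w.snd).sum_mul_gradient_le (differentiable_left hL w.snd w.fst) x
  simp only [hgrad, mul_zero, Finset.sum_const_zero] at this
  linarith

theorem mem_solution_of_snd_eq (hL : ContDiff ℝ 2 (fun w : Vec n × Vec m => L w.1 w.2))
    (hcc : IsConvexConcave L) {z w : OutputSpace n m} (hz : z ∈ Solution L)
    (hsnd : w.snd = z.snd) (h : L w.fst z.snd = L z.fst z.snd)
    (hgrad : ∀ j, ∇ (fun y => L w.fst y) w.snd j = 0) : w ∈ Solution L := by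
  refine ⟨fun y => ?_, fun x => by rw [hsnd, h]; exact hz.2 x⟩
  have := (hcc.2 w.fst).le_sum_mul_gradient (differentiable_right hL w.fst w.snd) y
  simp only [hgrad, mul_zero, Finset.sum_const_zero] at this
  linarith

end Saddle

/-! ### Coordinates on the output space -/

section Coordinates

variable {n m : ℕ}

/-- The coordinates of a point of the output space. -/
def toCoord (z : OutputSpace n m) : Fin n ⊕ Fin m → ℝ := Sum.elim z.fst z.snd

/-- The point of the output space with given coordinates. -/
def ofCoord (w : Fin n ⊕ Fin m → ℝ) : OutputSpace n m :=
  WithLp.toLp 2 (WithLp.toLp 2 (w ∘ Sum.inl), WithLp.toLp 2 (w ∘ Sum.inr))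

@[simp] theorem toCoord_inl (z : OutputSpace n m) (i : Fin n) : toCoord z (.inl i) = z.fst i := rfl

@[simp] theorem toCoord_inr (z : OutputSpace n m) (j : Fin m) : toCoord z (.inr j) = z.snd j := rfl

@[simp] theorem ofCoord_fst_apply (w : Fin n ⊕ Fin m → ℝ) (i : Fin n) :
    (ofCoord w).fst i = w (.inl i) := rfl

@[simp] theorem ofCoord_snd_apply (w : Fin n ⊕ Fin m → ℝ) (j : Fin m) :
    (ofCoord w).snd j = w (.inr j) := rfl

@[simp] theorem ofCoord_toCoord (z : OutputSpace n m) : ofCoord (toCoord z) = z := rfl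

@[simp] theorem toCoord_ofCoord (w : Fin n ⊕ Fin m → ℝ) : toCoord (ofCoord w) = w := by
  ext (i | j) <;> rfl

theorem continuous_toCoord : Continuous (toCoord (n := n) (m := m)) := by
  refine continuous_pi fun s => ?_
  rcases s with i | j
  · exact (EuclideanSpace.proj (𝕜 := ℝ) i).continuous.comp (WithLp.continuous_fst 2 _ _)
  · exact (EuclideanSpace.proj (𝕜 := ℝ) j).continuous.comp (WithLp.continuous_snd 2 _ _)

theorem contDiff_ofCoord_prod {r : WithTop ℕ∞} :
    ContDiff ℝ r fun w : Fin n ⊕ Fin m → ℝ => ((ofCoord w).fst, (ofCoord w).snd) :=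
  (contDiff_euclidean.2 fun i => contDiff_apply ℝ ℝ (Sum.inl i)).prodMk
    (contDiff_euclidean.2 fun j => contDiff_apply ℝ ℝ (Sum.inr j))

theorem continuous_ofCoord : Continuous (ofCoord (n := n) (m := m)) :=
  (WithLp.prod_continuous_toLp 2 _ _).comp (contDiff_ofCoord_prod (r := 0)).continuous

/-- The descent-ascent direction of `L`, in coordinates. -/
noncomputable def descentAscentField (L : Vec n → Vec m → ℝ) (w : Fin n ⊕ Fin m → ℝ) :
    Fin n ⊕ Fin m → ℝ :=
  Sum.elim (fun i => -∇ (fun x => L x (ofCoord w).snd) (ofCoord w).fst i)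
    (fun j => ∇ (fun y => L (ofCoord w).fst y) (ofCoord w).snd j)

variable {L : Vec n → Vec m → ℝ}

theorem contDiff_descentAscentField (hL : ContDiff ℝ 2 (fun w : Vec n × Vec m => L w.1 w.2)) :
    ContDiff ℝ 1 (descentAscentField L) := by
  have h12 : (1 : WithTop ℕ∞) + 1 ≤ 2 := by rw [one_add_one_eq_two]
  have h1 : ContDiff ℝ 1 fun w : Vec n × Vec m => ∇ (fun x => L x w.2) w.1 :=
    (InnerProductSpace.toDual ℝ (Vec n)).symm.contDiff.comp
      (ContDiff.fderiv (f := fun (w : Vec n × Vec m) x => L x w.2)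
        (hL.comp (contDiff_snd.prodMk (contDiff_snd.comp contDiff_fst))) contDiff_fst h12)
  have h2 : ContDiff ℝ 1 fun w : Vec n × Vec m => ∇ (fun y => L w.1 y) w.2 :=
    (InnerProductSpace.toDual ℝ (Vec m)).symm.contDiff.comp
      (ContDiff.fderiv (f := fun (w : Vec n × Vec m) y => L w.1 y)
        (hL.comp ((contDiff_fst.comp contDiff_fst).prodMk contDiff_snd)) contDiff_snd h12)
  rw [contDiff_pi]
  rintro (i | j)
  · exact (contDiff_euclidean.1 (h1.comp contDiff_ofCoord_prod) i).neg
  · exact contDiff_euclidean.1 (h2.comp contDiff_ofCoord_prod) j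

theorem sum_mul_descentAscentField (z : OutputSpace n m) (w : Fin n ⊕ Fin m → ℝ) :
    ∑ s, (w s - toCoord z s) * descentAscentField L w s =
      descentAscentPairing L z.fst (ofCoord w).fst z.snd (ofCoord w).snd := by
  rw [Fintype.sum_sum_type]; rfl

end Coordinates

/-! ### Stability -/

/-- By compactness, any sequence of times tending to infinity has a subsequence along which `z`
converges, so only limit points matter. -/
theorem tendsto_of_forall_limit {X Y : Type*} [PseudoMetricSpace X] [TopologicalSpace Y]
    {K : Set X} (hK : IsCompact K) {z : ℝ → X} (hz : ∀ t, 0 ≤ t → z t ∈ K) {f : X → Y}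
    (hf : Continuous f) {y : Y}
    (h : ∀ w ∈ K, ∀ u : ℕ → ℝ, Tendsto u atTop atTop → Tendsto (z ∘ u) atTop (𝓝 w) → f w = y) :
    Tendsto (fun t => f (z t)) atTop (𝓝 y) := by
  refine tendsto_of_subseq_tendsto fun u hu => ?_
  obtain ⟨N, hN⟩ := eventually_atTop.1 (hu.eventually_ge_atTop 0)
  obtain ⟨w, hw, φ, hφ, hlim⟩ := hK.tendsto_subseq
    (x := fun k => z (u (k + N))) fun k => hz _ (hN _ (Nat.le_add_left N k))
  have hu' : Tendsto (fun k => u (φ k + N)) atTop atTop :=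
    hu.comp ((tendsto_add_atTop_nat N).comp hφ.tendsto_atTop)
  refine ⟨fun k => φ k + N, ?_⟩
  rw [← h w hw _ hu' hlim]
  exact (hf.tendsto w).comp hlim

theorem exists_pos_Icc_subset {ι : Type*} [Finite ι] {I : ι → Set ℝ} {p : ι → ℝ}
    (ho : ∀ i, IsOpen (I i)) (hp : ∀ i, p i ∈ I i) :
    ∃ δ > 0, ∀ i, Icc (p i - δ) (p i + δ) ⊆ I i := by
  have : ∀ᶠ δ in 𝓝[>] (0 : ℝ), ∀ i, Icc (p i - δ) (p i + δ) ⊆ I i := by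
    refine eventually_all.2 fun i => ?_
    obtain ⟨ε, hε, hsub⟩ := Metric.nhds_basis_closedBall.mem_iff.1 ((ho i).mem_nhds (hp i))
    rw [Real.closedBall_eq_Icc] at hsub
    filter_upwards [nhdsWithin_le_nhds (eventually_lt_nhds hε)] with δ hδ
    exact (Icc_subset_Icc (by linarith) (by linarith)).trans hsub
  obtain ⟨δ, h1, h2⟩ := (this.and self_mem_nhdsWithin).exists
  exact ⟨δ, h2, h1⟩

section Main

variable {n m : ℕ} {dθ : Fin n → ℕ} {dφ : Fin m → ℕ}
  {L : Vec n → Vec m → ℝ} {f : ∀ i, Vec (dθ i) → ℝ} {g : ∀ j, Vec (dφ j) → ℝ}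
  {θ₀ : ∀ i, Vec (dθ i)} {φ₀ : ∀ j, Vec (dφ j)}

/-- The attainable ranges of the outputs, in coordinates. -/
def outputRange (f : ∀ i, Vec (dθ i) → ℝ) (g : ∀ j, Vec (dφ j) → ℝ) (θ₀ : ∀ i, Vec (dθ i))
    (φ₀ : ∀ j, Vec (dφ j)) : Fin n ⊕ Fin m → Set ℝ :=
  Sum.elim (fun i => ascentRange (f i) (θ₀ i)) (fun j => ascentRange (g j) (φ₀ j))

/-- The squared gradient norms that scale the output dynamics, in coordinates. -/
noncomputable def outputSpeed (f : ∀ i, Vec (dθ i) → ℝ) (g : ∀ j, Vec (dφ j) → ℝ)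
    (θ₀ : ∀ i, Vec (dθ i)) (φ₀ : ∀ j, Vec (dφ j)) : Fin n ⊕ Fin m → ℝ → ℝ :=
  Sum.elim (fun i c => ‖∇ (f i) (paramOfValue (f i) (θ₀ i) c)‖ ^ 2)
    (fun j c => ‖∇ (g j) (paramOfValue (g j) (φ₀ j) c)‖ ^ 2)

theorem isOutputTrajectory_iff {z : ℝ → OutputSpace n m} :
    IsOutputTrajectory L f g θ₀ φ₀ z ↔
      IsSeparableTrajectory (outputRange f g θ₀ φ₀) (outputSpeed f g θ₀ φ₀)
        (descentAscentField L) (fun t => toCoord (z t)) := by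
  simp only [IsOutputTrajectory, IsSeparableTrajectory, Sum.forall, outputRange, outputSpeed,
    descentAscentField, outputDomain, toCoord_inl, toCoord_inr, Sum.elim_inl, Sum.elim_inr,
    ofCoord_toCoord, mul_neg, mem_ofPred_eq, forall_and]

theorem mem_safeSolution_of_mem_solution {z w : OutputSpace n m}
    (hz : z ∈ SafeSolution L f g θ₀ φ₀) (hw : w ∈ Solution L)
    (hmem : ∀ s, toCoord w s ∈ outputRange f g θ₀ φ₀ s) : w ∈ SafeSolution L f g θ₀ φ₀ :=
  ⟨hw, fun i => ⟨(hz.2.1 i).1, hmem (.inl i)⟩, fun j => ⟨(hz.2.2 j).1, hmem (.inr j)⟩⟩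

/-- Limit points of a bounded trajectory along which the pairing with the displacement vanishes
asymptotically are solutions. -/
theorem mem_solution_of_tendsto (hL : ContDiff ℝ 2 (fun w : Vec n × Vec m => L w.1 w.2))
    (hLcc : IsStrictlyConvexConcave L) {z : OutputSpace n m} (hz : z ∈ Solution L)
    {K : Set (Fin n ⊕ Fin m → ℝ)} (hK : IsCompact K) {γ : ℝ → Fin n ⊕ Fin m → ℝ}
    (hγK : ∀ t, 0 ≤ t → γ t ∈ K)
    (hpair : Tendsto (fun t => ∑ s, (γ t s - toCoord z s) * descentAscentField L (γ t) s)
      atTop (𝓝 0))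
    (hvel : ∀ s, Tendsto (fun t => γ t s) atTop (𝓝 (toCoord z s)) →
      Tendsto (fun t => descentAscentField L (γ t) s) atTop (𝓝 0))
    {w : Fin n ⊕ Fin m → ℝ} {u : ℕ → ℝ} (hu : Tendsto u atTop atTop)
    (hw : Tendsto (γ ∘ u) atTop (𝓝 w)) : ofCoord w ∈ Solution L := by
  have hΦ := (contDiff_descentAscentField hL).continuous
  have hΦs : ∀ s, Continuous fun w => descentAscentField L w s :=
    fun s => (continuous_apply s).comp hΦ
  have hW : Continuous fun w => ∑ s, (w s - toCoord z s) * descentAscentField L w s :=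
    continuous_finsetSum _ fun s _ => ((continuous_apply s).sub continuous_const).mul (hΦs s)
  -- Stated for all limit points, not just the given one: the second use of Barbalat's lemma needs a
  -- whole block of `γ` to converge.
  have hvals : ∀ (w : Fin n ⊕ Fin m → ℝ) (u : ℕ → ℝ), Tendsto u atTop atTop →
      Tendsto (γ ∘ u) atTop (𝓝 w) →
      L z.fst (ofCoord w).snd = L z.fst z.snd ∧ L (ofCoord w).fst z.snd = L z.fst z.snd := by
    intro w u hu hw
    have := tendsto_nhds_unique ((hW.tendsto w).comp hw) (hpair.comp hu)
    rw [sum_mul_descentAscentField] at this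
    exact values_eq_of_pairing_nonneg hL hLcc.1 hz this.ge
  have hzero : ∀ s, Tendsto (fun t => γ t s) atTop (𝓝 (toCoord z s)) →
      descentAscentField L w s = 0 := fun s hs =>
    tendsto_nhds_unique (((hΦs s).tendsto w).comp hw) ((hvel s hs).comp hu)
  rcases hLcc.2 z.fst z.snd with hs | hs
  · have hfst : ∀ (w : Fin n ⊕ Fin m → ℝ) (u : ℕ → ℝ), Tendsto u atTop atTop →
        Tendsto (γ ∘ u) atTop (𝓝 w) → (ofCoord w).fst = z.fst :=
      fun w u hu hw => fst_eq_of_strictConvexOn hz hs (hvals w u hu hw).2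
    refine mem_solution_of_fst_eq hL hLcc.1 hz (hfst w u hu hw) (hvals w u hu hw).1 fun i => ?_
    refine neg_eq_zero.1 (hzero (.inl i) ?_)
    exact tendsto_of_forall_limit hK hγK (continuous_apply (Sum.inl i)) fun w _ u hu hw =>
      congrArg (fun x : Vec n => x i) (hfst w u hu hw)
  · have hsnd : ∀ (w : Fin n ⊕ Fin m → ℝ) (u : ℕ → ℝ), Tendsto u atTop atTop →
        Tendsto (γ ∘ u) atTop (𝓝 w) → (ofCoord w).snd = z.snd :=
      fun w u hu hw => snd_eq_of_strictConcaveOn hz hs (hvals w u hu hw).1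
    refine mem_solution_of_snd_eq hL hLcc.1 hz (hsnd w u hu hw) (hvals w u hu hw).2 fun j => ?_
    refine hzero (.inr j) ?_
    exact tendsto_of_forall_limit hK hγK (continuous_apply (Sum.inr j)) fun w _ u hu hw =>
      congrArg (fun y : Vec m => y j) (hsnd w u hu hw)

theorem eventually_exists_trajectory_and_approaches
    (hL : ContDiff ℝ 2 (fun w : Vec n × Vec m => L w.1 w.2))
    (hf : ∀ i, ContDiff ℝ 2 (f i)) (hg : ∀ j, ContDiff ℝ 2 (g j))
    (hLcc : IsStrictlyConvexConcave L) {z : OutputSpace n m}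
    (hz : z ∈ SafeSolution L f g θ₀ φ₀) :
    ∀ᶠ x₀ in 𝓝 z, (∃ γ, IsOutputTrajectory L f g θ₀ φ₀ γ ∧ γ 0 = x₀) ∧
      ∀ γ, IsOutputTrajectory L f g θ₀ φ₀ γ → γ 0 = x₀ →
        Approaches γ (SafeSolution L f g θ₀ φ₀) := by
  have ho : ∀ s, IsOpen (outputRange f g θ₀ φ₀ s) := Sum.rec
    (fun i => isOpen_ascentRange (hf i) (hz.2.1 i).1)
    (fun j => isOpen_ascentRange (hg j) (hz.2.2 j).1)
  have hc : ∀ s, OrdConnected (outputRange f g θ₀ φ₀ s) := Sum.rec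
    (fun i => ordConnected_ascentRange (hf i) (hz.2.1 i).1)
    (fun j => ordConnected_ascentRange (hg j) (hz.2.2 j).1)
  have hp : ∀ s, toCoord z s ∈ outputRange f g θ₀ φ₀ s :=
    Sum.rec (fun i => (hz.2.1 i).2) (fun j => (hz.2.2 j).2)
  have hρ : ∀ s, ContDiffOn ℝ 1 (outputSpeed f g θ₀ φ₀ s) (outputRange f g θ₀ φ₀ s) := Sum.rec
    (fun i => contDiffOn_norm_gradient_paramOfValue (hf i) (hz.2.1 i).1)
    (fun j => contDiffOn_norm_gradient_paramOfValue (hg j) (hz.2.2 j).1)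
  have hpos : ∀ s, ∀ c ∈ outputRange f g θ₀ φ₀ s, 0 < outputSpeed f g θ₀ φ₀ s c := Sum.rec
    (fun i _ h => norm_gradient_paramOfValue_pos (hf i) (hz.2.1 i).1 h)
    (fun j _ h => norm_gradient_paramOfValue_pos (hg j) (hz.2.2 j).1 h)
  have hΦ := contDiff_descentAscentField hL
  have hdec : ∀ w, ∑ s, (w s - toCoord z s) * descentAscentField L w s ≤ 0 := by
    intro w
    rw [sum_mul_descentAscentField]
    have h1 := descentAscentPairing_le hL hLcc.1 z.fst (ofCoord w).fst z.snd (ofCoord w).snd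
    have h2 := hz.1.1 (ofCoord w).snd
    have h3 := hz.1.2 (ofCoord w).fst
    linarith
  obtain ⟨δ, hδ, hI⟩ := exists_pos_Icc_subset ho hp
  obtain ⟨U, hU, hUex⟩ := exists_separableTrajectory hρ hpos hΦ hdec hδ hI
  obtain ⟨V, hV, hVlim⟩ := IsSeparableTrajectory.tendsto ho hc hρ hpos hΦ hdec hδ hI
  filter_upwards [continuous_toCoord.continuousAt hU, continuous_toCoord.continuousAt hV]
    with x₀ hxU hxV
  constructor
  · obtain ⟨γ, hγ, hγ0⟩ := hUex _ hxU
    refine ⟨fun t => ofCoord (γ t), isOutputTrajectory_iff.2 (by simpa using hγ), ?_⟩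
    simp [hγ0]
  · intro γ hγ hγ0
    obtain ⟨hbox, hpair, hvel⟩ := hVlim _ (isOutputTrajectory_iff.1 hγ) (hγ0 ▸ hxV)
    have hlim : Tendsto (fun t => Metric.infDist (ofCoord (toCoord (γ t)))
        (SafeSolution L f g θ₀ φ₀)) atTop (𝓝 0) :=
      tendsto_of_forall_limit isCompact_Icc hbox
        (f := fun w => Metric.infDist (ofCoord w) (SafeSolution L f g θ₀ φ₀))
        ((Metric.continuous_infDist_pt _).comp continuous_ofCoord) fun w hwK u hu hw => by
          refine Metric.infDist_zero_of_mem (mem_safeSolution_of_mem_solution hz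
            (mem_solution_of_tendsto hL hLcc hz.1 isCompact_Icc hbox hpair hvel hu hw) fun s => ?_)
          rw [toCoord_ofCoord]
          exact mem_of_mem_box hI hwK s
    intro ε hε
    obtain ⟨T, hT⟩ := eventually_atTop.1 (hlim.eventually_lt_const hε)
    exact ⟨max T 1, by positivity, fun t ht => hT t ((le_max_left T 1).trans ht.le)⟩

end Main

end HiddenGame

theorem mainTheorem8 {n m : ℕ} {dθ : Fin n → ℕ} {dφ : Fin m → ℕ}
    (L : HiddenGame.Vec n → HiddenGame.Vec m → ℝ)
    (f : ∀ i, HiddenGame.Vec (dθ i) → ℝ) (g : ∀ j, HiddenGame.Vec (dφ j) → ℝ)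
    (hL : ContDiff ℝ 2 (fun w : HiddenGame.Vec n × HiddenGame.Vec m => L w.1 w.2))
    (hf : ∀ i, ContDiff ℝ 2 (f i)) (hg : ∀ j, ContDiff ℝ 2 (g j))
    (hLcc : HiddenGame.IsStrictlyConvexConcave L)
    (θ₀ : ∀ i, HiddenGame.Vec (dθ i)) (φ₀ : ∀ j, HiddenGame.Vec (dφ j))
    (hZ : (HiddenGame.SafeSolution L f g θ₀ φ₀).Nonempty) :
    HiddenGame.IsAsymptoticallyStable (HiddenGame.IsOutputTrajectory L f g θ₀ φ₀)
      (HiddenGame.SafeSolution L f g θ₀ φ₀) := by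
  -- `R` is the set of all initial points with the required property; it is a neighborhood of each
  -- point of `Z`.
  exact ⟨_, mem_nhdsSet_iff_forall.2 fun z hz =>
    HiddenGame.eventually_exists_trajectory_and_approaches hL hf hg hLcc hz, fun _ h => h⟩
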